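/- Let $\omega_1,\omega_3$ be non-zero complex numbers with $\operatorname{Im}(\omega_3/\omega_1)>0$, put $\omega_2=-\omega_1-\omega_3$, and let $$\sigma(z)=z\prod_{(n,m)\in\mathbb{Z}^2\setminus\{(0,0)\}}\exp\left(\frac{z}{2n\omega_1+2m\omega_3}+\frac{z^2}{2(2n\omega_1+2m\omega_3)^2}\right)\left(1-\frac{z}{2n\omega_1+2m\omega_3}\right)$$ be the Weierstrass sigma function. For $j\in\{1,2,3\}$ put $$\eta_j=\frac{\sigma'(\omega_j)}{\sigma(\omega_j)},\qquad \sigma_j(z)=e^{\eta_j z}\,\frac{\sigma(\omega_j-z)}{\sigma(\omega_j)},\qquad \wp(z)=-(\log\sigma(z))''=-\left(\frac{\sigma'}{\sigma}\right)'(z),\qquad e_j=\wp(\omega_j).$$ Then for all $k,\ell\in\{1,2,3\}$ and every $z\in\mathbb{C}$, $$\sigma_k(z)^2-\sigma_\ell(z)^2+(e_k-e_\ell)\,\sigma(z)^2=0.$$ -/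

import Mathlib

namespace WeierstrassSigma

/-- The lattice point `2 n ω₁ + 2 m ω₃` attached to `p = (n, m)`. -/
def latticePoint (ω₁ ω₃ : ℂ) (p : ℤ × ℤ) : ℂ :=
  2 * (p.1 : ℂ) * ω₁ + 2 * (p.2 : ℂ) * ω₃

/-- The factor `exp (z / Ω + z ^ 2 / (2 Ω ^ 2)) * (1 - z / Ω)`, `Ω = 2 n ω₁ + 2 m ω₃`, of the
product of the sigma function. -/
noncomputable def sigmaFactor (ω₁ ω₃ z : ℂ) (p : ℤ × ℤ) : ℂ :=
  Complex.exp (z / latticePoint ω₁ ω₃ p + z ^ 2 / (2 * latticePoint ω₁ ω₃ p ^ 2)) *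
    (1 - z / latticePoint ω₁ ω₃ p)

/-- The Weierstrass sigma function with half-periods `ω₁, ω₃`; the product is over all
`(n, m) ≠ (0, 0)`. It converges unconditionally, see `multipliable_sigmaFactor`. -/
noncomputable def sigma (ω₁ ω₃ z : ℂ) : ℂ :=
  z * ∏' p : {p : ℤ × ℤ // p ≠ (0, 0)}, sigmaFactor ω₁ ω₃ z p

/-- The half-periods `ω₁, ω₂, ω₃`, at the indices `0, 1, 2 : Fin 3` in this order, where
`ω₁ + ω₂ + ω₃ = 0`. -/
def halfPeriod (ω₁ ω₃ : ℂ) : Fin 3 → ℂ := ![ω₁, -ω₁ - ω₃, ω₃]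

/-- `η_j = σ'(ω_j) / σ(ω_j)`. -/
noncomputable def eta (ω₁ ω₃ : ℂ) (j : Fin 3) : ℂ :=
  deriv (sigma ω₁ ω₃) (halfPeriod ω₁ ω₃ j) / sigma ω₁ ω₃ (halfPeriod ω₁ ω₃ j)

/-- The auxiliary sigma function `σ_j(z) = exp (η_j z) σ(ω_j - z) / σ(ω_j)`. -/
noncomputable def sigmaAux (ω₁ ω₃ : ℂ) (j : Fin 3) (z : ℂ) : ℂ :=
  Complex.exp (eta ω₁ ω₃ j * z) *
    (sigma ω₁ ω₃ (halfPeriod ω₁ ω₃ j - z) / sigma ω₁ ω₃ (halfPeriod ω₁ ω₃ j))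

/-- `℘ = -(log σ)''`. As `log σ` is multivalued, its first derivative is taken to be the
(single-valued) logarithmic derivative `σ' / σ`. -/
noncomputable def wp (ω₁ ω₃ z : ℂ) : ℂ :=
  -deriv (logDeriv (sigma ω₁ ω₃)) z

/-- `e_j = ℘(ω_j)`. -/
noncomputable def halfPeriodValue (ω₁ ω₃ : ℂ) (j : Fin 3) : ℂ :=
  wp ω₁ ω₃ (halfPeriod ω₁ ω₃ j)

/-- `2 ω₁` and `2 ω₃` form a pair of periods. -/
def periodPair (ω₁ ω₃ : ℂ) (h₁ : ω₁ ≠ 0) (hτ : 0 < (ω₃ / ω₁).im) : PeriodPair where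
  ω₁ := 2 * ω₁
  ω₂ := 2 * ω₃
  indep := by
    rw [LinearIndependent.pair_iff]
    intro s t hst
    have h : (s : ℂ) + t * (ω₃ / ω₁) = 0 := by
      simp only [Complex.real_smul] at hst
      field_simp
      linear_combination hst / 2
    have ht : t = 0 := by
      have := congrArg Complex.im h
      simpa [hτ.ne'] using this
    subst ht
    simpa using h

theorem elementaryFactor_isBigO :
    (fun w : ℂ => Complex.exp (w + w ^ 2 / 2) * (1 - w) - 1) =O[nhds 0] fun w => w ^ 3 := by
  have hneg : Filter.Tendsto (fun w : ℂ => -w) (nhds 0) (nhds 0) := by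
    simpa using (continuous_neg (G := ℂ)).tendsto 0
  have h1 : (fun w : ℂ => Complex.log (1 + -w) - Complex.logTaylor 3 (-w)) =O[nhds 0]
      fun w : ℂ => w ^ 3 := by
    have := (Complex.log_sub_logTaylor_isBigO 2).comp_tendsto hneg
    refine this.trans (Asymptotics.isBigO_of_le _ fun w => ?_)
    simp
  have h0 : Filter.Tendsto (fun w : ℂ => Complex.log (1 + -w) - Complex.logTaylor 3 (-w))
      (nhds 0) (nhds 0) :=
    h1.trans_tendsto (by simpa using (continuous_pow (M := ℂ) 3).tendsto 0)
  have h2 : (fun u : ℂ => Complex.exp u - 1) =O[nhds 0] fun u => u := by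
    simpa using ((Complex.hasDerivAt_exp 0).isBigO_sub)
  have h3 := (h2.comp_tendsto h0).trans h1
  refine h3.congr' ?_ Filter.EventuallyEq.rfl
  have hne : ∀ᶠ w : ℂ in nhds 0, w ≠ 1 := isOpen_ne.mem_nhds (by simp)
  filter_upwards [hne] with w hw
  have hw' : 1 + -w ≠ 0 := by
    intro h
    exact hw (by linear_combination -h)
  have : Complex.log (1 + -w) - Complex.logTaylor 3 (-w)
      = (w + w ^ 2 / 2) + Complex.log (1 + -w) := by
    simp [Complex.logTaylor, Finset.sum_range_succ]
    ring
  simp only [Function.comp_apply, this]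
  rw [Complex.exp_add, Complex.exp_log hw', sub_eq_add_neg 1 w]

/-- The infinite product in the definition of `sigma` converges unconditionally. -/
theorem multipliable_sigmaFactor (ω₁ ω₃ : ℂ) (h₁ : ω₁ ≠ 0) (hτ : 0 < (ω₃ / ω₁).im) (z : ℂ) :
    Multipliable fun p : {p : ℤ × ℤ // p ≠ (0, 0)} => sigmaFactor ω₁ ω₃ z p := by
  set L := periodPair ω₁ ω₃ h₁ hτ
  have hL : ∀ p, (L.latticeEquivProd.symm p : ℂ) = latticePoint ω₁ ω₃ p := by
    intro p
    rw [L.latticeEquiv_symm_apply]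
    simp only [L, periodPair, latticePoint]
    ring
  have hs : Summable fun p : {p : ℤ × ℤ // p ≠ (0, 0)} => (‖latticePoint ω₁ ω₃ p‖ ^ 3)⁻¹ := by
    have h := ZLattice.summable_norm_pow_inv L.lattice 3 (by simp)
    have h' := (L.latticeEquivProd.symm.toEquiv.summable_iff.mpr h).comp_injective
      (Subtype.val_injective (p := fun p : ℤ × ℤ => p ≠ (0, 0)))
    refine h'.congr fun p => ?_
    simp [← hL]
  have ht : Filter.Tendsto (fun p : {p : ℤ × ℤ // p ≠ (0, 0)} => z / latticePoint ω₁ ω₃ p)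
      Filter.cofinite (nhds 0) := by
    have h := hs.tendsto_cofinite_zero
    have h3 : Filter.Tendsto
        (fun p : {p : ℤ × ℤ // p ≠ (0, 0)} => ‖(latticePoint ω₁ ω₃ p)⁻¹‖)
        Filter.cofinite (nhds 0) := by
      have hc := ((Real.continuous_rpow_const (q := (1 / 3 : ℝ)) (by norm_num)).tendsto 0).comp h
      rw [Real.zero_rpow (by norm_num)] at hc
      refine hc.congr fun p => ?_
      simp only [Function.comp_apply, norm_inv, ← inv_pow]
      rw [← Real.rpow_natCast, ← Real.rpow_mul (by positivity)]
      norm_num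
    simpa [div_eq_mul_inv] using (tendsto_zero_iff_norm_tendsto_zero.mpr h3).const_mul z
  have hO := elementaryFactor_isBigO.comp_tendsto ht
  have hsum : Summable fun p : {p : ℤ × ℤ // p ≠ (0, 0)} =>
      ‖sigmaFactor ω₁ ω₃ z p - 1‖ := by
    refine summable_of_isBigO (hs.mul_left (‖z‖ ^ 3)) ?_
    refine (hO.norm_norm).congr (fun p => ?_) (fun p => ?_)
    · simp only [Function.comp_apply, sigmaFactor]
      congr 4
      rw [div_pow, div_div, mul_comm (2 : ℂ)]
    · simp only [Function.comp_apply, norm_pow, norm_div]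
      rw [div_pow, div_eq_mul_inv]
  simpa using multipliable_one_add_of_summable hsum

end WeierstrassSigma

open Filter Topology

namespace WeierstrassSigma

/-! For a half-period `ω`, the quotient `σ_ω² / σ²` is an even elliptic function with double poles
of leading coefficient 1 at the lattice points and a zero at `ω`. Its difference with `℘` has no
pole at the origin, evenness killing the `1/z` term, so it is entire and periodic, hence constant by
Liouville; evaluating at `ω` gives `σ_ω² = (℘ - ℘(ω)) σ²` (`sigmaHalf_sq`). Subtracting two such
identities eliminates `℘`, and continuity covers the lattice points.

The periodicity of the quotient (`sigmaQuot_add_period`) rests on the quasi-periodicity of `σ`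
(`sigma_add_period`), which is integrated twice from the periodicity of `℘ = -(σ'/σ)'`
(`wp_eq_weierstrassP`). -/

/-! ### The sigma product: convergence, holomorphy, zeros. -/

theorem latticeEquivProd_symm_eq_latticePoint (ω₁ ω₃ : ℂ) (h₁ : ω₁ ≠ 0)
    (hτ : 0 < (ω₃ / ω₁).im) (p : ℤ × ℤ) :
    ((periodPair ω₁ ω₃ h₁ hτ).latticeEquivProd.symm p : ℂ) = latticePoint ω₁ ω₃ p := by
  rw [PeriodPair.latticeEquiv_symm_apply]
  simp only [periodPair, latticePoint]
  ring

theorem latticePoint_mem_lattice (ω₁ ω₃ : ℂ) (h₁ : ω₁ ≠ 0)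
    (hτ : 0 < (ω₃ / ω₁).im) (p : ℤ × ℤ) :
    latticePoint ω₁ ω₃ p ∈ (periodPair ω₁ ω₃ h₁ hτ).lattice := by
  rw [← latticeEquivProd_symm_eq_latticePoint ω₁ ω₃ h₁ hτ]
  exact Subtype.property _

theorem latticePoint_eq_zero_iff (ω₁ ω₃ : ℂ) (h₁ : ω₁ ≠ 0)
    (hτ : 0 < (ω₃ / ω₁).im) (p : ℤ × ℤ) :
    latticePoint ω₁ ω₃ p = 0 ↔ p = (0, 0) := by
  rw [← latticeEquivProd_symm_eq_latticePoint ω₁ ω₃ h₁ hτ]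
  simp only [ZeroMemClass.coe_eq_zero, EmbeddingLike.map_eq_zero_iff]
  rfl

theorem summable_inv_norm_latticePoint_cube (ω₁ ω₃ : ℂ) (h₁ : ω₁ ≠ 0)
    (hτ : 0 < (ω₃ / ω₁).im) :
    Summable fun p : {p : ℤ × ℤ // p ≠ (0, 0)} => (‖latticePoint ω₁ ω₃ p‖ ^ 3)⁻¹ := by
  have h := ZLattice.summable_norm_pow_inv (periodPair ω₁ ω₃ h₁ hτ).lattice 3 (by simp)
  have h' := ((periodPair ω₁ ω₃ h₁ hτ).latticeEquivProd.symm.toEquiv.summable_iff.mpr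
    h).comp_injective (Subtype.val_injective (p := fun p : ℤ × ℤ => p ≠ (0, 0)))
  refine h'.congr fun p => ?_
  simp [← latticeEquivProd_symm_eq_latticePoint ω₁ ω₃ h₁ hτ]

/-- The locally uniform estimate of the factors of the sigma product. -/
theorem exists_norm_sigmaFactor_sub_one_le (ω₁ ω₃ : ℂ) (h₁ : ω₁ ≠ 0)
    (hτ : 0 < (ω₃ / ω₁).im) (R : ℝ) :
    ∃ C : ℝ, ∀ᶠ p : {p : ℤ × ℤ // p ≠ (0, 0)} in cofinite, ∀ z ∈ Metric.closedBall (0 : ℂ) R,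
      ‖sigmaFactor ω₁ ω₃ z p - 1‖ ≤ C * (‖latticePoint ω₁ ω₃ p‖ ^ 3)⁻¹ := by
  obtain ⟨C, hC⟩ := elementaryFactor_isBigO.bound
  obtain ⟨δ, hδ, hball⟩ := Metric.eventually_nhds_iff_ball.mp hC
  have hs := (summable_inv_norm_latticePoint_cube ω₁ ω₃ h₁ hτ).mul_left (|R| ^ 3)
  refine ⟨|C| * |R| ^ 3, ?_⟩
  -- The Taylor bound needs `‖z / Ω‖ < δ`; summability ensures this for all but finitely many `Ω`,
  -- uniformly in the ball.
  filter_upwards [hs.tendsto_cofinite_zero.eventually_lt_const (pow_pos hδ 3)] with p hp z hz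
  have hz' : ‖z‖ ≤ |R| := (mem_closedBall_zero_iff.mp hz).trans (le_abs_self R)
  have hle : ‖z / latticePoint ω₁ ω₃ p‖ ^ 3 ≤ |R| ^ 3 * (‖latticePoint ω₁ ω₃ p‖ ^ 3)⁻¹ := by
    rw [norm_div, div_pow, div_eq_mul_inv]
    gcongr
  have hlt : ‖z / latticePoint ω₁ ω₃ p‖ < δ := lt_of_pow_lt_pow_left₀ 3 hδ.le (hle.trans_lt hp)
  have hb := hball _ (mem_ball_zero_iff.mpr hlt)
  have he : sigmaFactor ω₁ ω₃ z p = Complex.exp (z / latticePoint ω₁ ω₃ p +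
      (z / latticePoint ω₁ ω₃ p) ^ 2 / 2) * (1 - z / latticePoint ω₁ ω₃ p) := by
    rw [sigmaFactor, div_pow, div_div, mul_comm (2 : ℂ)]
  rw [he]
  refine hb.trans ?_
  rw [norm_pow, mul_assoc]
  exact mul_le_mul (le_abs_self C) hle (by positivity) (abs_nonneg C)

/-- The infinite product in the definition of `sigma`. -/
noncomputable def sigmaProd (ω₁ ω₃ z : ℂ) : ℂ :=
  ∏' p : {p : ℤ × ℤ // p ≠ (0, 0)}, sigmaFactor ω₁ ω₃ z p

theorem sigma_eq_mul_sigmaProd (ω₁ ω₃ z : ℂ) : sigma ω₁ ω₃ z = z * sigmaProd ω₁ ω₃ z := rfl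

theorem differentiable_sigmaFactor (ω₁ ω₃ : ℂ) (p : ℤ × ℤ) :
    Differentiable ℂ fun z => sigmaFactor ω₁ ω₃ z p := by
  unfold sigmaFactor
  fun_prop

theorem hasProdLocallyUniformlyOn_sigmaFactor (ω₁ ω₃ : ℂ) (h₁ : ω₁ ≠ 0)
    (hτ : 0 < (ω₃ / ω₁).im) :
    HasProdLocallyUniformlyOn
      (fun (p : {p : ℤ × ℤ // p ≠ (0, 0)}) z => sigmaFactor ω₁ ω₃ z p)
      (sigmaProd ω₁ ω₃) Set.univ := by
  refine hasProdLocallyUniformlyOn_of_forall_compact isOpen_univ fun K _ hK => ?_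
  obtain ⟨R, hR⟩ := hK.isBounded.subset_closedBall 0
  obtain ⟨C, hC⟩ := exists_norm_sigmaFactor_sub_one_le ω₁ ω₃ h₁ hτ R
  have := Summable.hasProdUniformlyOn_one_add
    (f := fun (p : {p : ℤ × ℤ // p ≠ (0, 0)}) z => sigmaFactor ω₁ ω₃ z p - 1) hK
    ((summable_inv_norm_latticePoint_cube ω₁ ω₃ h₁ hτ).mul_left C)
    (hC.mono fun p hp z hz => hp z (hR hz))
    (fun p => ((differentiable_sigmaFactor ω₁ ω₃ p).continuous.sub
      continuous_const).continuousOn)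
  simp only [add_sub_cancel] at this
  exact this

theorem differentiable_sigmaProd (ω₁ ω₃ : ℂ) (h₁ : ω₁ ≠ 0) (hτ : 0 < (ω₃ / ω₁).im) :
    Differentiable ℂ (sigmaProd ω₁ ω₃) := by
  rw [← differentiableOn_univ]
  refine TendstoLocallyUniformlyOn.differentiableOn
    (hasProdLocallyUniformlyOn_sigmaFactor ω₁ ω₃ h₁ hτ) (.of_forall fun s => ?_) isOpen_univ
  exact DifferentiableOn.fun_finsetProd fun p _ =>
    (differentiable_sigmaFactor ω₁ ω₃ p).differentiableOn

theorem sigmaProd_zero (ω₁ ω₃ : ℂ) : sigmaProd ω₁ ω₃ 0 = 1 := by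
  simp [sigmaProd, sigmaFactor]

theorem sigmaProd_neg (ω₁ ω₃ z : ℂ) : sigmaProd ω₁ ω₃ (-z) = sigmaProd ω₁ ω₃ z := by
  let e : {p : ℤ × ℤ // p ≠ (0, 0)} ≃ {p : ℤ × ℤ // p ≠ (0, 0)} :=
    (Equiv.neg (ℤ × ℤ)).subtypeEquiv fun p => by
      change p ≠ 0 ↔ -p ≠ 0
      simp
  rw [sigmaProd, ← e.tprod_eq]
  refine tprod_congr fun p => ?_
  have : latticePoint ω₁ ω₃ (e p) = -latticePoint ω₁ ω₃ p := by
    simp [e, latticePoint]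
    ring
  simp [sigmaFactor, this]

theorem sigma_neg (ω₁ ω₃ z : ℂ) : sigma ω₁ ω₃ (-z) = -sigma ω₁ ω₃ z := by
  simp [sigma_eq_mul_sigmaProd, sigmaProd_neg]

theorem sigmaFactor_ne_zero (ω₁ ω₃ : ℂ) (h₁ : ω₁ ≠ 0) (hτ : 0 < (ω₃ / ω₁).im) {z : ℂ}
    (hz : z ∉ ((periodPair ω₁ ω₃ h₁ hτ).lattice : Set ℂ) \ {0}) {p : ℤ × ℤ} (hp : p ≠ (0, 0)) :
    latticePoint ω₁ ω₃ p ≠ 0 ∧ z - latticePoint ω₁ ω₃ p ≠ 0 ∧ sigmaFactor ω₁ ω₃ z p ≠ 0 := by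
  have hΩ := (latticePoint_eq_zero_iff ω₁ ω₃ h₁ hτ p).not.mpr hp
  have hne : z ≠ latticePoint ω₁ ω₃ p := by
    rintro rfl
    exact hz ⟨latticePoint_mem_lattice ω₁ ω₃ h₁ hτ p, hΩ⟩
  refine ⟨hΩ, sub_ne_zero.mpr hne, mul_ne_zero (Complex.exp_ne_zero _) ?_⟩
  rw [sub_ne_zero]
  intro h
  exact hne ((div_eq_one_iff_eq hΩ).mp h.symm)

/-- An absolutely convergent product of nonzero factors is nonzero. The origin is allowed, so that
one can divide by `sigmaProd` near it. -/
theorem sigmaProd_ne_zero (ω₁ ω₃ : ℂ) (h₁ : ω₁ ≠ 0) (hτ : 0 < (ω₃ / ω₁).im) {z : ℂ}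
    (hz : z ∉ ((periodPair ω₁ ω₃ h₁ hτ).lattice : Set ℂ) \ {0}) :
    sigmaProd ω₁ ω₃ z ≠ 0 := by
  obtain ⟨C, hC⟩ := exists_norm_sigmaFactor_sub_one_le ω₁ ω₃ h₁ hτ ‖z‖
  have hs : Summable fun p : {p : ℤ × ℤ // p ≠ (0, 0)} => ‖sigmaFactor ω₁ ω₃ z p - 1‖ := by
    refine ((summable_inv_norm_latticePoint_cube ω₁ ω₃ h₁ hτ).mul_left
      C).of_norm_bounded_eventually ?_
    filter_upwards [hC] with p hp
    simpa using hp z (by simp)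
  have := tprod_one_add_ne_zero_of_summable
    (f := fun p : {p : ℤ × ℤ // p ≠ (0, 0)} => sigmaFactor ω₁ ω₃ z p - 1)
    (fun p => by simpa using (sigmaFactor_ne_zero ω₁ ω₃ h₁ hτ hz p.2).2.2) hs
  simpa [sigmaProd] using this

theorem sigma_ne_zero (ω₁ ω₃ : ℂ) (h₁ : ω₁ ≠ 0) (hτ : 0 < (ω₃ / ω₁).im) {z : ℂ}
    (hz : z ∉ (periodPair ω₁ ω₃ h₁ hτ).lattice) : sigma ω₁ ω₃ z ≠ 0 := by
  refine mul_ne_zero ?_ (sigmaProd_ne_zero ω₁ ω₃ h₁ hτ fun h => hz h.1)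
  rintro rfl
  exact hz (zero_mem _)

theorem differentiable_sigma (ω₁ ω₃ : ℂ) (h₁ : ω₁ ≠ 0) (hτ : 0 < (ω₃ / ω₁).im) :
    Differentiable ℂ (sigma ω₁ ω₃) :=
  differentiable_id.mul (differentiable_sigmaProd ω₁ ω₃ h₁ hτ)

/-! ### Identification of `-(σ'/σ)'` with the lattice series of `℘`. -/

theorem logDeriv_sigmaFactor (ω₁ ω₃ : ℂ) (h₁ : ω₁ ≠ 0) (hτ : 0 < (ω₃ / ω₁).im) {z : ℂ}
    (hz : z ∉ ((periodPair ω₁ ω₃ h₁ hτ).lattice : Set ℂ) \ {0}) {p : ℤ × ℤ} (hp : p ≠ (0, 0)) :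
    logDeriv (fun w => sigmaFactor ω₁ ω₃ w p) z =
      1 / latticePoint ω₁ ω₃ p + z / latticePoint ω₁ ω₃ p ^ 2 +
        1 / (z - latticePoint ω₁ ω₃ p) := by
  obtain ⟨hΩ, hne, hf⟩ := sigmaFactor_ne_zero ω₁ ω₃ h₁ hτ hz hp
  set Ω := latticePoint ω₁ ω₃ p with hΩdef
  have hq : HasDerivAt (fun w : ℂ => w / Ω + w ^ 2 / (2 * Ω ^ 2))
      (1 / Ω + (2 * z) / (2 * Ω ^ 2)) z := by
    have h2 : HasDerivAt (fun w : ℂ => w ^ 2) (2 * z) z := by simpa using hasDerivAt_pow 2 z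
    exact ((hasDerivAt_id z).div_const Ω).add (h2.div_const _)
  have hl : HasDerivAt (fun w : ℂ => 1 - w / Ω) (-(1 / Ω)) z :=
    ((hasDerivAt_id z).div_const Ω).const_sub 1
  have hd := (hq.cexp.mul hl).deriv
  have hd' : deriv (fun w => sigmaFactor ω₁ ω₃ w p) z = _ := hd
  have hlz : 1 - z / Ω ≠ 0 := by
    have : 1 - z / Ω = -(z - Ω) / Ω := by field_simp; ring
    rw [this]
    exact div_ne_zero (neg_ne_zero.mpr hne) hΩ
  have hlz' : Ω - z ≠ 0 := by
    rw [← neg_sub]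
    exact neg_ne_zero.mpr hne
  rw [logDeriv_apply, hd', sigmaFactor, ← hΩdef]
  have hE := Complex.exp_ne_zero (z / Ω + z ^ 2 / (2 * Ω ^ 2))
  generalize Complex.exp (z / Ω + z ^ 2 / (2 * Ω ^ 2)) = E at hE ⊢
  have e1 : (E * (1 / Ω + 2 * z / (2 * Ω ^ 2)) * (1 - z / Ω) + E * -(1 / Ω)) / (E * (1 - z / Ω)) =
      (1 / Ω + 2 * z / (2 * Ω ^ 2)) - (1 / Ω) / (1 - z / Ω) := by
    field_simp
    ring
  have e2 : (1 / Ω) / (1 - z / Ω) = - (1 / (z - Ω)) := by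
    rw [div_div, mul_sub, mul_one, mul_div_cancel₀ _ hΩ, ← neg_sub z Ω, div_neg]
  rw [e1, e2]
  field_simp
  ring

/-- Locally uniform convergence of holomorphic functions passes to derivatives, and to quotients
with nonvanishing limit denominator. Hence the finite partial products may be differentiated
logarithmically, then once more. -/
theorem hasSum_deriv_logDeriv_sigmaProd (ω₁ ω₃ : ℂ) (h₁ : ω₁ ≠ 0) (hτ : 0 < (ω₃ / ω₁).im)
    {z : ℂ} (hz : z ∉ ((periodPair ω₁ ω₃ h₁ hτ).lattice : Set ℂ) \ {0}) :
    HasSum (fun p : {p : ℤ × ℤ // p ≠ (0, 0)} =>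
      1 / latticePoint ω₁ ω₃ p ^ 2 - 1 / (z - latticePoint ω₁ ω₃ p) ^ 2)
      (deriv (logDeriv (sigmaProd ω₁ ω₃)) z) := by
  set U : Set ℂ := (((periodPair ω₁ ω₃ h₁ hτ).lattice : Set ℂ) \ {0})ᶜ with hU
  have hUo : IsOpen U := (periodPair ω₁ ω₃ h₁ hτ).isOpen_compl_lattice_sdiff
  let F : Finset {p : ℤ × ℤ // p ≠ (0, 0)} → ℂ → ℂ :=
    fun s w => ∏ p ∈ s, sigmaFactor ω₁ ω₃ w p
  have hFd : ∀ s, Differentiable ℂ (F s) := fun s =>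
    Differentiable.fun_finsetProd fun p _ => differentiable_sigmaFactor ω₁ ω₃ p
  have hF0 : ∀ s, ∀ w ∈ U, F s w ≠ 0 := fun s w hw =>
    Finset.prod_ne_zero_iff.mpr fun p _ => (sigmaFactor_ne_zero ω₁ ω₃ h₁ hτ hw p.2).2.2
  have hP0 : ∀ w ∈ U, sigmaProd ω₁ ω₃ w ≠ 0 := fun w hw => sigmaProd_ne_zero ω₁ ω₃ h₁ hτ hw
  have hPd := differentiable_sigmaProd ω₁ ω₃ h₁ hτ
  have hF : TendstoLocallyUniformlyOn F (sigmaProd ω₁ ω₃) atTop U :=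
    ((hasProdLocallyUniformlyOn_sigmaFactor ω₁ ω₃ h₁ hτ).mono (Set.subset_univ U) :)
  have hdF := hF.deriv (.of_forall fun s => (hFd s).differentiableOn) hUo
  have hlog : TendstoLocallyUniformlyOn (fun s => logDeriv (F s))
      (logDeriv (sigmaProd ω₁ ω₃)) atTop U :=
    hdF.div₀ hF (hPd.differentiableOn.deriv hUo).continuousOn hPd.continuous.continuousOn hP0
  have hlogd := hlog.deriv (.of_forall fun s => ((hFd s).differentiableOn.deriv hUo).div
    (hFd s).differentiableOn (hF0 s)) hUo
  refine (hlogd.tendsto_at hz).congr fun s => ?_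
  have heq : logDeriv (F s) =ᶠ[𝓝 z] fun w => ∑ p ∈ s, (1 / latticePoint ω₁ ω₃ p +
      w / latticePoint ω₁ ω₃ p ^ 2 + 1 / (w - latticePoint ω₁ ω₃ p)) := by
    filter_upwards [hUo.mem_nhds hz] with w hw
    refine (logDeriv_prod
      (f := fun (p : {p : ℤ × ℤ // p ≠ (0, 0)}) w => sigmaFactor ω₁ ω₃ w p)
      (fun p _ => (sigmaFactor_ne_zero ω₁ ω₃ h₁ hτ hw p.2).2.2)
      fun p _ => differentiable_sigmaFactor ω₁ ω₃ p w).trans ?_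
    exact Finset.sum_congr rfl fun p _ => logDeriv_sigmaFactor ω₁ ω₃ h₁ hτ hw p.2
  rw [Function.comp_apply, heq.deriv_eq]
  refine (HasDerivAt.fun_sum fun p _ => ?_).deriv
  have hne := (sigmaFactor_ne_zero ω₁ ω₃ h₁ hτ hz p.2).2.1
  have h2 := ((hasDerivAt_id z).sub_const (latticePoint ω₁ ω₃ p)).fun_inv hne
  simpa [one_div, neg_div, sub_eq_add_neg] using
    (((hasDerivAt_id z).div_const (latticePoint ω₁ ω₃ p ^ 2)).const_add
      (1 / latticePoint ω₁ ω₃ p)).fun_add h2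

theorem deriv_logDeriv_sigmaProd (ω₁ ω₃ : ℂ) (h₁ : ω₁ ≠ 0) (hτ : 0 < (ω₃ / ω₁).im)
    {z : ℂ} (hz : z ∉ ((periodPair ω₁ ω₃ h₁ hτ).lattice : Set ℂ) \ {0}) :
    deriv (logDeriv (sigmaProd ω₁ ω₃)) z =
      -(periodPair ω₁ ω₃ h₁ hτ).weierstrassPExcept 0 z := by
  have h := (periodPair ω₁ ω₃ h₁ hτ).hasSum_weierstrassPExcept 0 z
  rw [← (periodPair ω₁ ω₃ h₁ hτ).latticeEquivProd.symm.toEquiv.hasSum_iff,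
    ← hasSum_subtype_iff_of_support_subset (s := {p : ℤ × ℤ | p ≠ (0, 0)})] at h
  · refine (hasSum_deriv_logDeriv_sigmaProd ω₁ ω₃ h₁ hτ hz).unique (h.neg.congr_fun ?_)
    rintro ⟨p, hp⟩
    have hΩ := (latticePoint_eq_zero_iff ω₁ ω₃ h₁ hτ p).not.mpr hp
    simp only [LinearEquiv.coe_toEquiv, Function.comp_apply,
      latticeEquivProd_symm_eq_latticePoint, if_neg hΩ, neg_sub]
  · intro p hp hp0
    refine hp ?_
    simp only [LinearEquiv.coe_toEquiv, Function.comp_apply,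
      latticeEquivProd_symm_eq_latticePoint]
    rw [if_pos ((latticePoint_eq_zero_iff ω₁ ω₃ h₁ hτ p).mpr hp0)]

theorem isOpen_compl_lattice (L : PeriodPair) : IsOpen (L.lattice : Set ℂ)ᶜ :=
  L.isClosed_lattice.isOpen_compl

theorem differentiableOn_logDeriv_sigma (ω₁ ω₃ : ℂ) (h₁ : ω₁ ≠ 0) (hτ : 0 < (ω₃ / ω₁).im) :
    DifferentiableOn ℂ (logDeriv (sigma ω₁ ω₃))
      ((periodPair ω₁ ω₃ h₁ hτ).lattice : Set ℂ)ᶜ :=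
  ((differentiable_sigma ω₁ ω₃ h₁ hτ).differentiableOn.deriv (isOpen_compl_lattice _)).div
    (differentiable_sigma ω₁ ω₃ h₁ hτ).differentiableOn
    fun _ hz => sigma_ne_zero ω₁ ω₃ h₁ hτ hz

/-- Away from the lattice, `wp` is Mathlib's Weierstrass function. -/
theorem wp_eq_weierstrassP (ω₁ ω₃ : ℂ) (h₁ : ω₁ ≠ 0) (hτ : 0 < (ω₃ / ω₁).im) {z : ℂ}
    (hz : z ∉ (periodPair ω₁ ω₃ h₁ hτ).lattice) :
    wp ω₁ ω₃ z = (periodPair ω₁ ω₃ h₁ hτ).weierstrassP z := by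
  set L := periodPair ω₁ ω₃ h₁ hτ with hL
  have hz' : z ∉ (L.lattice : Set ℂ) \ {0} := fun h => hz h.1
  have hne0 : ∀ {w}, w ∉ L.lattice → w ≠ 0 := fun hw h => hw (h ▸ zero_mem _)
  have hPd := differentiable_sigmaProd ω₁ ω₃ h₁ hτ
  -- The factor `z` of `σ` contributes `w⁻¹`, whose derivative supplies the pole term missing from
  -- `weierstrassPExcept 0`.
  have heq : logDeriv (sigma ω₁ ω₃) =ᶠ[𝓝 z] fun w => w⁻¹ + logDeriv (sigmaProd ω₁ ω₃) w := by
    filter_upwards [(isOpen_compl_lattice L).mem_nhds hz] with w hw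
    have := logDeriv_mul (f := fun x : ℂ => x) (g := sigmaProd ω₁ ω₃) w (hne0 hw)
      (sigmaProd_ne_zero ω₁ ω₃ h₁ hτ fun h => hw h.1) differentiableAt_id (hPd w)
    rw [logDeriv_id', one_div] at this
    exact this
  have hlogd : DifferentiableAt ℂ (logDeriv (sigmaProd ω₁ ω₃)) z :=
    ((hPd.differentiableOn.deriv isOpen_univ).differentiableAt univ_mem).div (hPd z)
      (sigmaProd_ne_zero ω₁ ω₃ h₁ hτ hz')
  have h0 := L.weierstrassPExcept_add 0 z
  rw [wp, heq.deriv_eq, ((hasDerivAt_inv (hne0 hz)).fun_add hlogd.hasDerivAt).deriv,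
    deriv_logDeriv_sigmaProd ω₁ ω₃ h₁ hτ hz', ← h0]
  simp
  ring

/-! ### Quasi-periodicity of sigma. -/

theorem countable_lattice (L : PeriodPair) : (L.lattice : Set ℂ).Countable :=
  (Set.countable_coe_iff (s := (L.lattice : Set ℂ))).mp
    L.latticeEquivProd.toEquiv.injective.countable

theorem dense_compl_lattice (L : PeriodPair) : Dense (L.lattice : Set ℂ)ᶜ :=
  (countable_lattice L).dense_compl ℂ

theorem logDeriv_sigma_neg (ω₁ ω₃ z : ℂ) :
    logDeriv (sigma ω₁ ω₃) (-z) = -logDeriv (sigma ω₁ ω₃) z := by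
  have h : (fun w => sigma ω₁ ω₃ (-w)) = fun w => -sigma ω₁ ω₃ w :=
    funext fun w => sigma_neg ω₁ ω₃ w
  have hd : deriv (sigma ω₁ ω₃) (-z) = deriv (sigma ω₁ ω₃) z := by
    have := congrArg (fun f => deriv f z) h
    simp only [deriv_comp_neg, deriv.fun_neg] at this
    exact neg_injective this
  rw [logDeriv_apply, logDeriv_apply, hd, sigma_neg, div_neg]

/-- The difference has derivative `℘(z) - ℘(z + v) = 0`, and the complement of a countable set in
the plane is connected. -/
theorem logDeriv_sigma_add_period (ω₁ ω₃ : ℂ) (h₁ : ω₁ ≠ 0) (hτ : 0 < (ω₃ / ω₁).im) {v : ℂ}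
    (hv : v ∈ (periodPair ω₁ ω₃ h₁ hτ).lattice) :
    ∃ a : ℂ, ∀ z ∉ (periodPair ω₁ ω₃ h₁ hτ).lattice,
      logDeriv (sigma ω₁ ω₃) (z + v) = logDeriv (sigma ω₁ ω₃) z + a := by
  set L := periodPair ω₁ ω₃ h₁ hτ
  have hU := isOpen_compl_lattice L
  have hconn : IsPreconnected (L.lattice : Set ℂ)ᶜ :=
    ((countable_lattice L).isConnected_compl_of_one_lt_rank (by simp)).2
  have hmem : ∀ z ∈ (L.lattice : Set ℂ)ᶜ, z + v ∈ (L.lattice : Set ℂ)ᶜ := fun z hz h =>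
    hz ((add_mem_cancel_right hv).mp h)
  have hd : ∀ z ∈ (L.lattice : Set ℂ)ᶜ, HasDerivAt (logDeriv (sigma ω₁ ω₃))
      (-L.weierstrassP z) z := fun z hz => by
    rw [← wp_eq_weierstrassP ω₁ ω₃ h₁ hτ hz, wp, neg_neg]
    exact ((differentiableOn_logDeriv_sigma ω₁ ω₃ h₁ hτ).differentiableAt
      (hU.mem_nhds hz)).hasDerivAt
  have hd2 : ∀ z ∈ (L.lattice : Set ℂ)ᶜ, HasDerivAt (fun w =>
      logDeriv (sigma ω₁ ω₃) (w + v) - logDeriv (sigma ω₁ ω₃) w) 0 z := fun z hz => by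
    have := ((hd _ (hmem z hz)).comp_add_const z v).fun_sub (hd z hz)
    have hper := L.weierstrassP_add_coe z ⟨v, hv⟩
    simp only at hper
    rwa [hper, sub_self] at this
  obtain ⟨a, ha⟩ := hU.exists_is_const_of_deriv_eq_zero hconn
    (fun z hz => (hd2 z hz).differentiableAt.differentiableWithinAt)
    (fun z hz => (hd2 z hz).deriv)
  refine ⟨a, fun z hz => ?_⟩
  rw [← ha z hz]
  ring

/-- Quasi-periodicity of the sigma function. -/
theorem sigma_add_period (ω₁ ω₃ : ℂ) (h₁ : ω₁ ≠ 0) (hτ : 0 < (ω₃ / ω₁).im) {v : ℂ}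
    (hv : v ∈ (periodPair ω₁ ω₃ h₁ hτ).lattice) :
    ∃ a b : ℂ, b ≠ 0 ∧ (∀ z ∉ (periodPair ω₁ ω₃ h₁ hτ).lattice,
        logDeriv (sigma ω₁ ω₃) (z + v) = logDeriv (sigma ω₁ ω₃) z + a) ∧
      ∀ z, sigma ω₁ ω₃ (z + v) = b * Complex.exp (a * z) * sigma ω₁ ω₃ z := by
  obtain ⟨a, ha⟩ := logDeriv_sigma_add_period ω₁ ω₃ h₁ hτ hv
  set L := periodPair ω₁ ω₃ h₁ hτ
  have hU := isOpen_compl_lattice L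
  have hconn : IsPreconnected (L.lattice : Set ℂ)ᶜ :=
    ((countable_lattice L).isConnected_compl_of_one_lt_rank (by simp)).2
  have hσ := differentiable_sigma ω₁ ω₃ h₁ hτ
  have hf : Differentiable ℂ fun z => sigma ω₁ ω₃ (z + v) := hσ.comp (by fun_prop)
  have he : Differentiable ℂ fun z => Complex.exp (a * z) := by fun_prop
  have hg : Differentiable ℂ fun z => Complex.exp (a * z) * sigma ω₁ ω₃ z := he.mul hσ
  have hlog : Set.EqOn (logDeriv fun z => sigma ω₁ ω₃ (z + v))
      (logDeriv fun z => Complex.exp (a * z) * sigma ω₁ ω₃ z) (L.lattice : Set ℂ)ᶜ := by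
    intro z hz
    have hexp : deriv (fun w => Complex.exp (a * w)) z = Complex.exp (a * z) * a := by
      simpa using ((hasDerivAt_id z).const_mul a).cexp.deriv
    rw [logDeriv_mul (f := fun w => Complex.exp (a * w)) z (Complex.exp_ne_zero _) (sigma_ne_zero ω₁ ω₃ h₁ hτ hz) (he z) (hσ z),
      logDeriv_apply (fun w => Complex.exp (a * w)), hexp,
      mul_div_cancel_left₀ _ (Complex.exp_ne_zero _), add_comm, ← ha z hz, logDeriv_apply,
      logDeriv_apply, deriv_comp_add_const]
  obtain ⟨b, hb, hEq⟩ := (logDeriv_eqOn_iff hf.differentiableOn hg.differentiableOn hU hconn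
    (fun z hz => mul_ne_zero (Complex.exp_ne_zero _) (sigma_ne_zero ω₁ ω₃ h₁ hτ hz))
    (fun z hz => sigma_ne_zero ω₁ ω₃ h₁ hτ fun h => hz ((add_mem_cancel_right hv).mp h))).mp hlog
  refine ⟨a, b, hb, ha, fun z => ?_⟩
  have := congrFun (Continuous.ext_on (dense_compl_lattice L) hf.continuous
    (hg.continuous.const_smul b) hEq) z
  simpa [mul_assoc] using this

/-- Translation by `2ω` sends `-ω` to `ω`, so oddness of `σ` and of `σ'/σ` determines both
quasi-period constants. -/
theorem sigma_add_two_mul_halfPeriod (ω₁ ω₃ : ℂ) (h₁ : ω₁ ≠ 0) (hτ : 0 < (ω₃ / ω₁).im) {ω : ℂ}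
    (hω : ω ∉ (periodPair ω₁ ω₃ h₁ hτ).lattice) (h2ω : 2 * ω ∈ (periodPair ω₁ ω₃ h₁ hτ).lattice)
    (z : ℂ) :
    sigma ω₁ ω₃ (z + 2 * ω) =
      -Complex.exp (2 * logDeriv (sigma ω₁ ω₃) ω * (z + ω)) * sigma ω₁ ω₃ z := by
  obtain ⟨a, b, -, ha, h⟩ := sigma_add_period ω₁ ω₃ h₁ hτ h2ω
  have hneg : -ω + 2 * ω = ω := by ring
  have haω := ha (-ω) (by rwa [neg_mem_iff])
  rw [hneg, logDeriv_sigma_neg] at haω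
  have ha' : a = 2 * logDeriv (sigma ω₁ ω₃) ω := by linear_combination -haω
  have hbω := h (-ω)
  rw [hneg, sigma_neg] at hbω
  have hσ := sigma_ne_zero ω₁ ω₃ h₁ hτ hω
  have hb : b * Complex.exp (a * -ω) = -1 :=
    mul_right_cancel₀ hσ (by linear_combination hbω)
  have hb' : b = -Complex.exp (a * ω) := by
    calc b = b * Complex.exp (a * -ω) * Complex.exp (a * ω) := by
          rw [mul_assoc, ← Complex.exp_add, mul_neg, neg_add_cancel, Complex.exp_zero, mul_one]
      _ = _ := by rw [hb, neg_one_mul]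
  rw [h z, hb', ← ha', mul_add, add_comm (a * z), Complex.exp_add]
  ring

/-! ### Parity and periodicity of the squared quotients. -/

/-- The auxiliary sigma function of a half-period `ω`. -/
noncomputable def sigmaHalf (ω₁ ω₃ ω z : ℂ) : ℂ :=
  Complex.exp (logDeriv (sigma ω₁ ω₃) ω * z) * (sigma ω₁ ω₃ (ω - z) / sigma ω₁ ω₃ ω)

theorem differentiable_sigmaHalf (ω₁ ω₃ : ℂ) (h₁ : ω₁ ≠ 0) (hτ : 0 < (ω₃ / ω₁).im) (ω : ℂ) :
    Differentiable ℂ (sigmaHalf ω₁ ω₃ ω) := by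
  have h : Differentiable ℂ fun z => sigma ω₁ ω₃ (ω - z) :=
    (differentiable_sigma ω₁ ω₃ h₁ hτ).comp (by fun_prop)
  unfold sigmaHalf
  fun_prop

theorem sigmaHalf_neg (ω₁ ω₃ : ℂ) (h₁ : ω₁ ≠ 0) (hτ : 0 < (ω₃ / ω₁).im) {ω : ℂ}
    (hω : ω ∉ (periodPair ω₁ ω₃ h₁ hτ).lattice) (h2ω : 2 * ω ∈ (periodPair ω₁ ω₃ h₁ hτ).lattice)
    (z : ℂ) : sigmaHalf ω₁ ω₃ ω (-z) = sigmaHalf ω₁ ω₃ ω z := by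
  have h := sigma_add_two_mul_halfPeriod ω₁ ω₃ h₁ hτ hω h2ω (-(ω - z))
  have e1 : -(ω - z) + 2 * ω = ω - -z := by ring
  have e2 : -(ω - z) + ω = z := by ring
  rw [e1, e2, sigma_neg] at h
  rw [sigmaHalf, sigmaHalf, h]
  have e3 : Complex.exp (2 * logDeriv (sigma ω₁ ω₃) ω * z) =
      Complex.exp (logDeriv (sigma ω₁ ω₃) ω * z) * Complex.exp (logDeriv (sigma ω₁ ω₃) ω * z) := by
    rw [← Complex.exp_add]
    ring_nf
  have e4 : Complex.exp (logDeriv (sigma ω₁ ω₃) ω * -z) *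
      Complex.exp (logDeriv (sigma ω₁ ω₃) ω * z) = 1 := by
    rw [← Complex.exp_add, mul_neg, neg_add_cancel, Complex.exp_zero]
  rw [e3]
  linear_combination (Complex.exp (logDeriv (sigma ω₁ ω₃) ω * z) *
    (sigma ω₁ ω₃ (ω - z) / sigma ω₁ ω₃ ω)) * e4

/-- The square of the quotient of an auxiliary sigma function by the sigma function. -/
noncomputable def sigmaQuot (ω₁ ω₃ ω z : ℂ) : ℂ :=
  sigmaHalf ω₁ ω₃ ω z ^ 2 / sigma ω₁ ω₃ z ^ 2

theorem sigmaQuot_neg (ω₁ ω₃ : ℂ) (h₁ : ω₁ ≠ 0) (hτ : 0 < (ω₃ / ω₁).im) {ω : ℂ}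
    (hω : ω ∉ (periodPair ω₁ ω₃ h₁ hτ).lattice) (h2ω : 2 * ω ∈ (periodPair ω₁ ω₃ h₁ hτ).lattice)
    (z : ℂ) : sigmaQuot ω₁ ω₃ ω (-z) = sigmaQuot ω₁ ω₃ ω z := by
  rw [sigmaQuot, sigmaQuot, sigmaHalf_neg ω₁ ω₃ h₁ hτ hω h2ω, sigma_neg, neg_sq]

theorem sigmaQuot_ne_zero (ω₁ ω₃ : ℂ) (h₁ : ω₁ ≠ 0) (hτ : 0 < (ω₃ / ω₁).im) {ω z : ℂ}
    (hω : ω ∉ (periodPair ω₁ ω₃ h₁ hτ).lattice) (hz : z ∉ (periodPair ω₁ ω₃ h₁ hτ).lattice)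
    (hωz : ω - z ∉ (periodPair ω₁ ω₃ h₁ hτ).lattice) : sigmaQuot ω₁ ω₃ ω z ≠ 0 :=
  div_ne_zero (pow_ne_zero 2 (mul_ne_zero (Complex.exp_ne_zero _)
    (div_ne_zero (sigma_ne_zero ω₁ ω₃ h₁ hτ hωz) (sigma_ne_zero ω₁ ω₃ h₁ hτ hω))))
    (pow_ne_zero 2 (sigma_ne_zero ω₁ ω₃ h₁ hτ hz))

/-- The `z`-dependent exponentials from `σ(ω - z)` and `σ(z)` cancel in the quotient, leaving a
constant multiplier. -/
theorem exists_sigmaQuot_add_period (ω₁ ω₃ : ℂ) (h₁ : ω₁ ≠ 0) (hτ : 0 < (ω₃ / ω₁).im) (ω : ℂ)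
    {v : ℂ} (hv : v ∈ (periodPair ω₁ ω₃ h₁ hτ).lattice) :
    ∃ c : ℂ, ∀ z, sigmaQuot ω₁ ω₃ ω (z + v) = c * sigmaQuot ω₁ ω₃ ω z := by
  obtain ⟨a, b, hb, -, h⟩ := sigma_add_period ω₁ ω₃ h₁ hτ hv
  set η := logDeriv (sigma ω₁ ω₃) ω with hη
  refine ⟨Complex.exp (η * v) ^ 2 / (Complex.exp (a * (ω - v)) ^ 2 * b ^ 4), fun z => ?_⟩
  have h' := h (ω - (z + v))
  have e1 : ω - (z + v) + v = ω - z := by ring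
  have e2 : a * (ω - (z + v)) = a * (ω - v) - a * z := by ring
  rw [e1, e2, Complex.exp_sub] at h'
  rw [sigmaQuot, sigmaQuot, sigmaHalf, sigmaHalf, h z, h', ← hη, mul_add, Complex.exp_add]
  have hA := Complex.exp_ne_zero (a * z)
  have hB := Complex.exp_ne_zero (a * (ω - v))
  generalize Complex.exp (a * z) = A at hA ⊢
  generalize Complex.exp (a * (ω - v)) = B at hB ⊢
  simp only [div_eq_mul_inv, mul_pow, mul_inv]
  generalize (sigma ω₁ ω₃ z) = s
  generalize (sigma ω₁ ω₃ ω) = t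
  field_simp

theorem sigmaQuot_add_two_mul_halfPeriod (ω₁ ω₃ : ℂ) (h₁ : ω₁ ≠ 0) (hτ : 0 < (ω₃ / ω₁).im)
    {ω : ℂ} (hω : ω ∉ (periodPair ω₁ ω₃ h₁ hτ).lattice)
    (h2ω : 2 * ω ∈ (periodPair ω₁ ω₃ h₁ hτ).lattice) (z : ℂ) :
    sigmaQuot ω₁ ω₃ ω (z + 2 * ω) = sigmaQuot ω₁ ω₃ ω z := by
  have hE := Complex.exp_ne_zero (2 * logDeriv (sigma ω₁ ω₃) ω * (z + ω))
  have hσ := sigma_add_two_mul_halfPeriod ω₁ ω₃ h₁ hτ hω h2ω z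
  have hhalf : sigmaHalf ω₁ ω₃ ω (z + 2 * ω) =
      -Complex.exp (2 * logDeriv (sigma ω₁ ω₃) ω * (z + ω)) * sigmaHalf ω₁ ω₃ ω z := by
    rw [← sigmaHalf_neg ω₁ ω₃ h₁ hτ hω h2ω z, sigmaHalf, sigmaHalf]
    have e1 : ω - (z + 2 * ω) = -(ω - -z) := by ring
    have e2 : logDeriv (sigma ω₁ ω₃) ω * (z + 2 * ω) =
      2 * logDeriv (sigma ω₁ ω₃) ω * (z + ω) + logDeriv (sigma ω₁ ω₃) ω * -z := by ring
    rw [e1, sigma_neg, e2, Complex.exp_add]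
    ring
  rw [sigmaQuot, sigmaQuot, hσ, hhalf, mul_pow, mul_pow,
    mul_div_mul_left _ _ (pow_ne_zero 2 (neg_ne_zero.mpr hE))]

theorem sigmaQuot_add_period_add_period (ω₁ ω₃ : ℂ) (h₁ : ω₁ ≠ 0) (hτ : 0 < (ω₃ / ω₁).im)
    {ω : ℂ} (hω : ω ∉ (periodPair ω₁ ω₃ h₁ hτ).lattice)
    (h2ω : 2 * ω ∈ (periodPair ω₁ ω₃ h₁ hτ).lattice) {v : ℂ}
    (hv : v ∈ (periodPair ω₁ ω₃ h₁ hτ).lattice) (z : ℂ) :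
    sigmaQuot ω₁ ω₃ ω (z + v + v) = sigmaQuot ω₁ ω₃ ω z := by
  obtain ⟨c, hc⟩ := exists_sigmaQuot_add_period ω₁ ω₃ h₁ hτ ω hv
  -- At `ω / 2` the quotient has neither zero nor pole. Evenness makes its values at `±(ω / 2)` and
  -- `±(ω / 2 + v)` agree, which forces `c² = 1`.
  have hhalf : ω / 2 ∉ (periodPair ω₁ ω₃ h₁ hτ).lattice := fun h => hω (by
    simpa using add_mem h h)
  have hne := sigmaQuot_ne_zero ω₁ ω₃ h₁ hτ hω hhalf (by rwa [sub_half])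
  have h := hc (-(ω / 2 + v))
  have e : -(ω / 2 + v) + v = -(ω / 2) := by ring
  rw [e, sigmaQuot_neg ω₁ ω₃ h₁ hτ hω h2ω, sigmaQuot_neg ω₁ ω₃ h₁ hτ hω h2ω, hc] at h
  have hcc : c * c = 1 := mul_right_cancel₀ hne (by linear_combination -h)
  rw [hc, hc, ← mul_assoc, hcc, one_mul]

/-- Evenness at `-v / 2` forces multiplier 1 unless `v / 2` is a pole or a zero of the quotient. In
those cases `v`, respectively `2ω - v`, is twice a period, and doubled periods are already settled.
-/
theorem sigmaQuot_add_period (ω₁ ω₃ : ℂ) (h₁ : ω₁ ≠ 0) (hτ : 0 < (ω₃ / ω₁).im)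
    {ω : ℂ} (hω : ω ∉ (periodPair ω₁ ω₃ h₁ hτ).lattice)
    (h2ω : 2 * ω ∈ (periodPair ω₁ ω₃ h₁ hτ).lattice) {v : ℂ}
    (hv : v ∈ (periodPair ω₁ ω₃ h₁ hτ).lattice) (z : ℂ) :
    sigmaQuot ω₁ ω₃ ω (z + v) = sigmaQuot ω₁ ω₃ ω z := by
  by_cases hv2 : v / 2 ∈ (periodPair ω₁ ω₃ h₁ hτ).lattice
  · rw [← sigmaQuot_add_period_add_period ω₁ ω₃ h₁ hτ hω h2ω hv2 z, add_assoc, add_halves]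
  by_cases hvω : ω - v / 2 ∈ (periodPair ω₁ ω₃ h₁ hτ).lattice
  · rw [← sigmaQuot_add_two_mul_halfPeriod ω₁ ω₃ h₁ hτ hω h2ω z,
      ← sigmaQuot_add_period_add_period ω₁ ω₃ h₁ hτ hω h2ω hvω (z + v)]
    ring_nf
  obtain ⟨c, hc⟩ := exists_sigmaQuot_add_period ω₁ ω₃ h₁ hτ ω hv
  have h := hc (-(v / 2))
  rw [sigmaQuot_neg ω₁ ω₃ h₁ hτ hω h2ω, neg_add_eq_sub, sub_half] at h
  have hc1 : c = 1 := mul_right_cancel₀ (sigmaQuot_ne_zero ω₁ ω₃ h₁ hτ hω hv2 hvω)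
    (by linear_combination -h)
  rw [hc, hc1, one_mul]

/-! ### Removing the pole and applying Liouville's theorem. -/

/-- The difference of `sigmaQuot` and the Weierstrass function extends holomorphically
over the origin. -/
theorem exists_differentiableOn_eq_sigmaQuot_sub_weierstrassP (ω₁ ω₃ : ℂ) (h₁ : ω₁ ≠ 0)
    (hτ : 0 < (ω₃ / ω₁).im) {ω : ℂ} (hω : ω ∉ (periodPair ω₁ ω₃ h₁ hτ).lattice)
    (h2ω : 2 * ω ∈ (periodPair ω₁ ω₃ h₁ hτ).lattice) :
    ∃ M : ℂ → ℂ, DifferentiableOn ℂ M (((periodPair ω₁ ω₃ h₁ hτ).lattice : Set ℂ) \ {0})ᶜ ∧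
      ∀ z ∉ (periodPair ω₁ ω₃ h₁ hτ).lattice,
        M z = sigmaQuot ω₁ ω₃ ω z - (periodPair ω₁ ω₃ h₁ hτ).weierstrassP z := by
  set L := periodPair ω₁ ω₃ h₁ hτ with hL
  set V : Set ℂ := ((L.lattice : Set ℂ) \ {0})ᶜ with hV
  have hVn : V ∈ 𝓝 (0 : ℂ) := L.compl_lattice_sdiff_singleton_mem_nhds 0
  -- This is `z² (σ_ω² / σ² - ℘)` with its singularity at 0 removed; the `1` is `z²` times the pole
  -- term of `℘`.
  let N : ℂ → ℂ := fun z =>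
    sigmaHalf ω₁ ω₃ ω z ^ 2 / sigmaProd ω₁ ω₃ z ^ 2 - z ^ 2 * L.weierstrassPExcept 0 z - 1
  have hN : DifferentiableOn ℂ N V := by
    refine DifferentiableOn.sub_const (DifferentiableOn.sub (DifferentiableOn.div
      ((differentiable_sigmaHalf ω₁ ω₃ h₁ hτ ω).pow 2).differentiableOn
      ((differentiable_sigmaProd ω₁ ω₃ h₁ hτ).pow 2).differentiableOn fun z hz =>
        pow_ne_zero 2 (sigmaProd_ne_zero ω₁ ω₃ h₁ hτ hz)) (DifferentiableOn.mul
      (differentiable_id.pow 2).differentiableOn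
      (L.differentiableOn_weierstrassPExcept 0))) 1
  have hN0 : N 0 = 0 := by
    simp [N, sigmaHalf, sigmaProd_zero, sigma_ne_zero ω₁ ω₃ h₁ hτ hω]
  have hNeven : (fun z => N (-z)) = N := by
    funext z
    simp only [N, sigmaHalf_neg ω₁ ω₃ h₁ hτ hω h2ω, sigmaProd_neg, neg_sq,
      L.weierstrassPExcept_neg, neg_zero]
  have hdN0 : deriv N 0 = 0 := by
    have h : deriv (fun z => N (-z)) 0 = deriv N 0 := by rw [hNeven]
    rw [deriv_comp_neg, neg_zero] at h
    linear_combination -h / 2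
  -- Since `N` and `N'` vanish at 0, the iterated slope equals `N z / z²` away from 0 and stays
  -- holomorphic at 0.
  refine ⟨dslope (dslope N 0) 0, ?_, fun z hz => ?_⟩
  · rwa [Complex.differentiableOn_dslope hVn, Complex.differentiableOn_dslope hVn]
  have hz0 : z ≠ 0 := fun h => hz (h ▸ zero_mem _)
  have hP : sigmaProd ω₁ ω₃ z ≠ 0 := sigmaProd_ne_zero ω₁ ω₃ h₁ hτ fun h => hz h.1
  have hE := L.weierstrassPExcept_add 0 z
  simp only [ZeroMemClass.coe_zero, sub_zero] at hE
  rw [dslope_of_ne _ hz0, slope_def_field, dslope_same, hdN0, dslope_of_ne _ hz0,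
    slope_def_field, hN0, ← hE, sigmaQuot, sigma_eq_mul_sigmaProd]
  simp only [N]
  field_simp
  ring

/-- The square of the auxiliary sigma function in terms of the Weierstrass function. -/
theorem sigmaHalf_sq (ω₁ ω₃ : ℂ) (h₁ : ω₁ ≠ 0) (hτ : 0 < (ω₃ / ω₁).im) {ω : ℂ}
    (hω : ω ∉ (periodPair ω₁ ω₃ h₁ hτ).lattice) (h2ω : 2 * ω ∈ (periodPair ω₁ ω₃ h₁ hτ).lattice)
    {z : ℂ} (hz : z ∉ (periodPair ω₁ ω₃ h₁ hτ).lattice) :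
    sigmaHalf ω₁ ω₃ ω z ^ 2 =
      (wp ω₁ ω₃ z - wp ω₁ ω₃ ω) * sigma ω₁ ω₃ z ^ 2 := by
  classical
  obtain ⟨M, hM, hMeq⟩ :=
    exists_differentiableOn_eq_sigmaQuot_sub_weierstrassP ω₁ ω₃ h₁ hτ hω h2ω
  rw [wp_eq_weierstrassP ω₁ ω₃ h₁ hτ hz, wp_eq_weierstrassP ω₁ ω₃ h₁ hτ hω]
  set L := periodPair ω₁ ω₃ h₁ hτ with hL
  have hVo : IsOpen ((L.lattice : Set ℂ) \ {0})ᶜ := L.isOpen_compl_lattice_sdiff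
  -- The value `M 0` is used at every lattice point, so `H` is periodic and its differentiability
  -- there reduces to that at the origin.
  let H : ℂ → ℂ := fun w =>
    if w ∈ L.lattice then M 0 else sigmaQuot ω₁ ω₃ ω w - L.weierstrassP w
  have hHM : ∀ w ∈ ((L.lattice : Set ℂ) \ {0})ᶜ, H w = M w := by
    intro w hw
    by_cases hwL : w ∈ L.lattice
    · have : w = 0 := by
        by_contra h
        exact hw ⟨hwL, h⟩
      simp [H, this]
    · rw [hMeq w hwL]
      exact if_neg hwL
  have hper : ∀ w v, v ∈ L.lattice → H (w + v) = H w := by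
    intro w v hv
    simp only [H, add_mem_cancel_right hv, sigmaQuot_add_period ω₁ ω₃ h₁ hτ hω h2ω hv,
      L.weierstrassP_add_coe w ⟨v, hv⟩]
  have hdiffV : ∀ w ∈ ((L.lattice : Set ℂ) \ {0})ᶜ, DifferentiableAt ℂ H w := fun w hw =>
    (hM.differentiableAt (hVo.mem_nhds hw)).congr_of_eventuallyEq
      (eventually_of_mem (hVo.mem_nhds hw) hHM)
  have hdiff : Differentiable ℂ H := by
    intro w
    by_cases hwL : w ∈ L.lattice
    · have h0 : DifferentiableAt ℂ H (w + -w) := by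
        rw [add_neg_cancel]
        exact hdiffV 0 (by simp)
      have h := (h0.hasDerivAt.comp_add_const w (-w)).differentiableAt
      exact h.congr_of_eventuallyEq (.of_forall fun u => (hper u (-w) (neg_mem hwL)).symm)
    · exact hdiffV w fun h => hwL h.1
  have hconst := hdiff.apply_eq_apply_of_bounded
    (IsZLattice.isCompact_range_of_periodic L.lattice H hdiff.continuous hper).isBounded z ω
  simp only [H, if_neg hz, if_neg hω] at hconst
  have hQω : sigmaQuot ω₁ ω₃ ω ω = 0 := by
    simp [sigmaQuot, sigmaHalf, sigma_eq_mul_sigmaProd]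
  have hQ : sigmaQuot ω₁ ω₃ ω z = L.weierstrassP z - L.weierstrassP ω := by
    linear_combination hconst + hQω
  rw [← hQ, sigmaQuot, div_mul_cancel₀ _ (pow_ne_zero 2 (sigma_ne_zero ω₁ ω₃ h₁ hτ hz))]

/-! ### The three half-periods and the conclusion. -/

theorem halfPeriod_notMem_lattice (ω₁ ω₃ : ℂ) (h₁ : ω₁ ≠ 0) (hτ : 0 < (ω₃ / ω₁).im) (j : Fin 3) :
    halfPeriod ω₁ ω₃ j ∉ (periodPair ω₁ ω₃ h₁ hτ).lattice := by
  set L := periodPair ω₁ ω₃ h₁ hτ with hL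
  have e1 : L.ω₁ = 2 * ω₁ := rfl
  have e2 : L.ω₂ = 2 * ω₃ := rfl
  fin_cases j
  · have h : ω₁ = L.ω₁ / 2 := by rw [e1]; ring
    simpa [halfPeriod, ← h] using L.ω₁_div_two_notMem_lattice
  · have h := (L.mul_ω₁_add_mul_ω₂_mem_lattice (α := -1 / 2) (β := -1 / 2)).not.mpr (by norm_num)
    have e : ((-1 / 2 : ℚ) : ℂ) * L.ω₁ + ((-1 / 2 : ℚ) : ℂ) * L.ω₂ = -ω₁ - ω₃ := by
      rw [e1, e2]; push_cast; ring
    rw [e] at h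
    simpa [halfPeriod] using h
  · have h : ω₃ = L.ω₂ / 2 := by rw [e2]; ring
    simpa [halfPeriod, ← h] using L.ω₂_div_two_notMem_lattice

theorem two_mul_halfPeriod_mem_lattice (ω₁ ω₃ : ℂ) (h₁ : ω₁ ≠ 0) (hτ : 0 < (ω₃ / ω₁).im)
    (j : Fin 3) : 2 * halfPeriod ω₁ ω₃ j ∈ (periodPair ω₁ ω₃ h₁ hτ).lattice := by
  have m1 : 2 * ω₁ ∈ (periodPair ω₁ ω₃ h₁ hτ).lattice := PeriodPair.ω₁_mem_lattice _
  have m2 : 2 * ω₃ ∈ (periodPair ω₁ ω₃ h₁ hτ).lattice := PeriodPair.ω₂_mem_lattice _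
  fin_cases j
  · exact m1
  · have e : 2 * halfPeriod ω₁ ω₃ 1 = -(2 * ω₁) - 2 * ω₃ := by
      simp only [halfPeriod, Matrix.cons_val_one, Matrix.cons_val_zero]
      ring
    change 2 * halfPeriod ω₁ ω₃ 1 ∈ _
    rw [e]
    exact sub_mem (neg_mem m1) m2
  · exact m2

theorem sigmaAux_eq_sigmaHalf (ω₁ ω₃ : ℂ) (j : Fin 3) :
    sigmaAux ω₁ ω₃ j = sigmaHalf ω₁ ω₃ (halfPeriod ω₁ ω₃ j) := rfl

end WeierstrassSigma

open WeierstrassSigma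

theorem theorem3 (ω₁ ω₃ : ℂ) (h₁ : ω₁ ≠ 0) (h₃ : ω₃ ≠ 0) (hτ : 0 < (ω₃ / ω₁).im)
    (k l : Fin 3) (z : ℂ) :
    WeierstrassSigma.sigmaAux ω₁ ω₃ k z ^ 2 - WeierstrassSigma.sigmaAux ω₁ ω₃ l z ^ 2 +
      (WeierstrassSigma.halfPeriodValue ω₁ ω₃ k - WeierstrassSigma.halfPeriodValue ω₁ ω₃ l) *
        WeierstrassSigma.sigma ω₁ ω₃ z ^ 2 = 0 := by
  have hhalf : ∀ j, Continuous (sigmaAux ω₁ ω₃ j) := fun j =>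
    (differentiable_sigmaHalf ω₁ ω₃ h₁ hτ (halfPeriod ω₁ ω₃ j)).continuous
  have hσ : Continuous (sigma ω₁ ω₃) := (differentiable_sigma ω₁ ω₃ h₁ hτ).continuous
  have hcont : Continuous fun w => sigmaAux ω₁ ω₃ k w ^ 2 - sigmaAux ω₁ ω₃ l w ^ 2 +
      (halfPeriodValue ω₁ ω₃ k - halfPeriodValue ω₁ ω₃ l) * sigma ω₁ ω₃ w ^ 2 :=
    (((hhalf k).pow 2).sub ((hhalf l).pow 2)).add (continuous_const.mul (hσ.pow 2))
  -- Both sides are continuous, so it suffices to argue off the lattice, where `sigmaHalf_sq`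
  -- applies.
  refine congrFun (hcont.ext_on (dense_compl_lattice (periodPair ω₁ ω₃ h₁ hτ))
    (continuous_const (y := (0 : ℂ))) fun w hw => ?_) z
  have hsq : ∀ j, sigmaAux ω₁ ω₃ j w ^ 2 =
      (wp ω₁ ω₃ w - halfPeriodValue ω₁ ω₃ j) * sigma ω₁ ω₃ w ^ 2 := fun j => by
    rw [sigmaAux_eq_sigmaHalf]
    exact sigmaHalf_sq ω₁ ω₃ h₁ hτ (halfPeriod_notMem_lattice ω₁ ω₃ h₁ hτ j)
      (two_mul_halfPeriod_mem_lattice ω₁ ω₃ h₁ hτ j) hw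
  simp only [hsq]
  ring
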